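/- **Theorem (the mimetic canonical integrator is symplectic).** Let $p\ge 1$. Let $\tilde\tau^1<\dots<\tilde\tau^p$ be the Gauss–Legendre nodes in $(-1,1)$ (the roots of the Legendre polynomial $P_p$), let $-1=\tau^0<\dots<\tau^p=1$ be the Gauss–Lobatto–Legendre nodes (the roots of $(1-\tau^2)P_p'(\tau)$), let $l_0,\dots,l_p$ be the Lagrange polynomials on $\tau^0,\dots,\tau^p$, let $e_l=-\sum_{k=0}^{l-1} l_k'$ ($l=1,\dots,p$) be the edge polynomials, and let $\mathsf E^{k,l}=1$ if $k=l$, $-1$ if $k=l-1$, and $0$ otherwise. One step, of length $\Delta t\neq 0$, of the *mimetic canonical integrator* (MCI) for an autonomous system $\dot y=h(y)$ with phase space $U\subseteq\mathbb R^M$ takes $y^0$ to $y^p$, where $y^0,\dots,y^p\in\mathbb R^M$ satisfy, with $y_h(\tau)=\sum_{k=0}^p y^k l_k(\tau)$, $$y_h(\tilde\tau^j)\in U,\qquad \frac{2}{\Delta t}\sum_{l=1}^{p}\sum_{k=0}^{p}\mathsf E^{k,l}\,e_l(\tilde\tau^j)\,y^k = h\big(y_h(\tilde\tau^j)\big),\qquad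 j=1,\dots,p .$$ 1. *Symplecticity.* Let $U\subseteq\mathbb R^{2n}$ be open, let $H:U\to\mathbb R$ be smooth, and let $h$ be the Hamiltonian vector field $\dot q_i=\partial H/\partial p_i$, $\dot p_i=-\partial H/\partial q_i$. Let $\omega=\sum_i dq_i\wedge dp_i$. - (a) If $W\subseteq\mathbb R^{2n}$ is open and $y\mapsto (Y^0(y),\dots,Y^p(y))$ is a differentiable family on $W$ of solutions of the MCI equations with $Y^0(y)=y$, then the one-step map $\Phi=Y^p$ satisfies $\Phi^*\omega=\omega$ on $W$. - (b) If, in (a), the family is smooth and $\Phi$ is injective on $W$, then $\Phi$ is a symplectic map on $W$, that is, a smooth diffeomorphism of $W$ onto an open set which preserves $\omega$. - (c) Every $x\in U$ has open neighbourhoods $W\subseteq N\subseteq U$, and there is $\delta>0$, such that for all $0<|\Delta t|<\delta$ and each $y\in W$ the MCI equations have exactly one solution with $y^0=y$ and $y^0,\dots,y^p\in N$; this solution depends smoothly on $y\in W$, and the one-step map $\Phi_{\Delta t}:y\mapsto y^p$ is a symplectic map on $W$. 2. *Runge–Kutta form.* For every $M$, $U\subseteq\mathbb R^M$, $h$ and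 $\Delta t\ne0$, and all $y_0,y_1\in\mathbb R^M$: the MCI takes $y_0$ to $y_1$ in one step if and only if the $p$-stage Runge–Kutta method with Gauss coefficients does (with stage points in $U$), and if and only if collocation at the Gauss nodes does. The Gauss coefficients are $c_i=(\tilde\tau^i+1)/2$, $a_{ij}=\int_0^{c_i}\ell_j$, $b_j=\int_0^1\ell_j$, with $\ell_j$ the Lagrange polynomials on $c_1,\dots,c_p$. Collocation takes $y_0$ to $y_1$ if there is a polynomial $u$ of degree at most $p$ with $u(0)=y_0$, $u(1)=y_1$, and $u(c_i)\in U$, $u'(c_i)=\Delta t\,h(u(c_i))$ for all $i$. The method is implicit: $a_{ij}\neq0$ for some $i\le j$. 3. *Quadratic first integrals.* For every $M$, $U\subseteq\mathbb R^M$, $h$ and symmetric real $M\times M$ matrix $\mathsf C$ with $y^{t}\mathsf C\,h(y)=0$ for all $y\in U$, every solution of the MCI equations satisfies $(y^p)^{t}\mathsf C\,y^p=(y^0)^{t}\mathsf C\,y^0$. -/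

import Mathlib

open Polynomial
open scoped ContDiff

noncomputable section

/-! ### Legendre polynomials and the two families of nodes on `[-1, 1]` -/

/-- The Legendre polynomial `P_n = (1 / (2^n n!)) (d/dx)^n (x^2 - 1)^n`. -/
def legendrePoly (n : ℕ) : ℝ[X] :=
  C (1 / (2 ^ n * (n.factorial : ℝ))) * derivative^[n] ((X ^ 2 - 1) ^ n)

theorem legendrePoly_iterate_ne_zero (n k : ℕ) (hk : k ≤ 2 * n) :
    derivative^[k] ((X ^ 2 - 1 : ℝ[X]) ^ n) ≠ 0 := by
  have hd : ((X ^ 2 - 1 : ℝ[X]) ^ n).natDegree = 2 * n := by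
    rw [natDegree_pow]
    have : (X ^ 2 - 1 : ℝ[X]).natDegree = 2 := by
      simpa using natDegree_X_pow_sub_C (R := ℝ) (n := 2) (r := 1)
    rw [this, mul_comm]
  have hm : ((X ^ 2 - 1 : ℝ[X]) ^ n).Monic := by
    have : (X ^ 2 - 1 : ℝ[X]).Monic := by
      simpa using monic_X_pow_sub_C (R := ℝ) (1 : ℝ) (n := 2) (by norm_num)
    exact this.pow n
  intro h0
  have hc := coeff_iterate_derivative (p := (X ^ 2 - 1 : ℝ[X]) ^ n) (k := k) (2 * n - k)
  rw [h0] at hc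
  have e : 2 * n - k + k = 2 * n := by omega
  have hl : ((X ^ 2 - 1 : ℝ[X]) ^ n).coeff (2 * n) = 1 := by
    have := hm.coeff_natDegree
    rwa [hd] at this
  rw [e, hl] at hc
  have hpos : (2 * n).descFactorial k ≠ 0 := by
    rw [Ne, Nat.descFactorial_eq_zero_iff_lt]; omega
  rw [coeff_zero, nsmul_eq_mul, mul_one] at hc
  exact hpos (by exact_mod_cast hc.symm)

theorem legendrePoly_natDegree_iterate_le (n k : ℕ) :
    (derivative^[k] ((X ^ 2 - 1 : ℝ[X]) ^ n)).natDegree ≤ 2 * n - k := by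
  refine (natDegree_iterate_derivative _ k).trans ?_
  have : (X ^ 2 - 1 : ℝ[X]).natDegree = 2 := by
    simpa using natDegree_X_pow_sub_C (R := ℝ) (n := 2) (r := 1)
  rw [natDegree_pow, this, mul_comm]

theorem legendrePoly_endpoints_mem (n k : ℕ) (hk : k < n) :
    ({-1, 1} : Finset ℝ) ⊆ (derivative^[k] ((X ^ 2 - 1 : ℝ[X]) ^ n)).roots.toFinset := by
  have hdvd : (X ^ 2 - 1 : ℝ[X]) ∣ derivative^[k] ((X ^ 2 - 1 : ℝ[X]) ^ n) :=
    (dvd_pow_self _ (by omega : n - k ≠ 0)).trans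
      (pow_sub_dvd_iterate_derivative_of_pow_dvd k dvd_rfl)
  obtain ⟨r, hr⟩ := hdvd
  intro x hx
  rw [Multiset.mem_toFinset, mem_roots (legendrePoly_iterate_ne_zero n k (by omega)), IsRoot.def,
    hr]
  simp only [Finset.mem_insert, Finset.mem_singleton] at hx
  rcases hx with rfl | rfl <;> simp

theorem legendrePoly_card_iterate (n k : ℕ) (hk : k < n) :
    k + 2 ≤ (derivative^[k] ((X ^ 2 - 1 : ℝ[X]) ^ n)).roots.toFinset.card := by
  induction k with
  | zero =>
    have := Finset.card_le_card (legendrePoly_endpoints_mem n 0 hk)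
    rwa [Finset.card_pair (by norm_num)] at this
  | succ k ih =>
    have h1 := ih (by omega)
    have h2 := card_roots_toFinset_le_card_roots_derivative_sdiff_roots_succ
      (derivative^[k] ((X ^ 2 - 1 : ℝ[X]) ^ n))
    rw [← Function.iterate_succ_apply' (f := derivative), Nat.succ_eq_add_one] at h2
    have h3 := legendrePoly_endpoints_mem n k (by omega)
    have h4 := legendrePoly_endpoints_mem n (k + 1) hk
    have hsub := Finset.union_subset (Finset.sdiff_subset
      (s := (derivative^[k + 1] ((X ^ 2 - 1 : ℝ[X]) ^ n)).roots.toFinset)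
      (t := (derivative^[k] ((X ^ 2 - 1 : ℝ[X]) ^ n)).roots.toFinset)) h4
    have hdisj : Disjoint ((derivative^[k + 1] ((X ^ 2 - 1 : ℝ[X]) ^ n)).roots.toFinset \
        (derivative^[k] ((X ^ 2 - 1 : ℝ[X]) ^ n)).roots.toFinset) ({-1, 1} : Finset ℝ) :=
      Finset.disjoint_of_subset_right h3 Finset.sdiff_disjoint
    have h5 := Finset.card_le_card hsub
    rw [Finset.card_union_of_disjoint hdisj, Finset.card_pair (by norm_num)] at h5
    omega

/-- `P_n` has exactly `n` distinct real roots. -/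
theorem legendrePoly_card_roots (n : ℕ) : (legendrePoly n).roots.toFinset.card = n := by
  have hc : (1 / (2 ^ n * (n.factorial : ℝ))) ≠ 0 := by positivity
  rw [legendrePoly, roots_C_mul _ hc]
  apply le_antisymm
  · refine (Multiset.toFinset_card_le _).trans ((card_roots' _).trans ?_)
    exact (legendrePoly_natDegree_iterate_le n n).trans (by omega)
  · rcases n with _ | n
    · simp
    · have h1 := legendrePoly_card_iterate (n + 1) n (by omega)
      have h2 := card_roots_toFinset_le_derivative (derivative^[n] ((X ^ 2 - 1 : ℝ[X]) ^ (n + 1)))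
      rw [← Function.iterate_succ_apply' (f := derivative), Nat.succ_eq_add_one] at h2
      omega

/-- `P_n'` has exactly `n - 1` distinct real roots. -/
theorem legendrePoly_card_roots_derivative (n : ℕ) :
    (derivative (legendrePoly n)).roots.toFinset.card = n - 1 := by
  apply le_antisymm
  · refine (Multiset.toFinset_card_le _).trans ((card_roots' _).trans ?_)
    refine (natDegree_derivative_le _).trans (Nat.sub_le_sub_right ?_ 1)
    refine (natDegree_C_mul_le _ _).trans ?_
    exact (legendrePoly_natDegree_iterate_le n n).trans (by omega)
  · have h := card_roots_toFinset_le_derivative (legendrePoly n)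
    rw [legendrePoly_card_roots] at h
    omega

/-- The `p` Gauss–Legendre nodes: the roots of `P_p` in increasing order. -/
def gaussNode (p : ℕ) (j : Fin p) : ℝ :=
  (legendrePoly p).roots.toFinset.orderEmbOfFin (legendrePoly_card_roots p) j

/-- The `p + 1` Gauss–Lobatto–Legendre nodes (for `1 ≤ p`): `-1`, then the roots of `P_p'` in
increasing order, then `1`. -/
def lobattoNode (p : ℕ) (i : Fin (p + 1)) : ℝ :=
  if h0 : i = 0 then -1
  else if h1 : i = Fin.last p then 1
  else (derivative (legendrePoly p)).roots.toFinset.orderEmbOfFin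
    (legendrePoly_card_roots_derivative p)
    ⟨i.val - 1, by
      have a := Fin.val_ne_iff.mpr h0
      have b := Fin.val_ne_iff.mpr h1
      have c := i.isLt
      simp only [Fin.val_zero, Fin.val_last] at a b
      omega⟩

/-! ### Basis forms, incidence matrix and the mimetic canonical integrator -/

/-- The basis 0-forms of the primal grid: `l_k`, the Lagrange polynomials of degree `p` on the
Gauss–Lobatto–Legendre nodes. -/
def primalBasis (p : ℕ) (k : Fin (p + 1)) : ℝ[X] :=
  Lagrange.basis Finset.univ (lobattoNode p) k

/-- The edge polynomials `e_l = - ∑_{k = 0}^{l - 1} l_k'` for `l = 1, …, p`; the index `l : Fin p`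
stands for the edge number `l + 1`, which joins the nodes `l` and `l + 1`. -/
def edgePoly (p : ℕ) (l : Fin p) : ℝ[X] :=
  -∑ k ∈ Finset.Iic l.castSucc, derivative (primalBasis p k)

/-- The incidence matrix: the edge from the node `l` to the node `l + 1` has boundary
`(node l + 1) - (node l)`. -/
def incidence (p : ℕ) : Matrix (Fin (p + 1)) (Fin p) ℝ :=
  fun k l => if k = l.succ then 1 else if k = l.castSucc then -1 else 0

variable {V : Type*} [AddCommGroup V] [Module ℝ V]

/-- The polynomial trajectory `y_h(τ) = ∑_k y^k l_k(τ)` with the nodal values `Y k = y^k`. -/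
def trajectory (p : ℕ) (Y : Fin (p + 1) → V) (τ : ℝ) : V :=
  ∑ k, (primalBasis p k).eval τ • Y k

/-- The equations of one step, of length `Δt`, of the mimetic canonical integrator for the system
`y' = h(y)` on the phase space `U`. The time interval is mapped to `[-1, 1]` with `√g = Δt / 2`, so
that the Hodge star sends `dτ` to `2 / Δt`. -/
def IsMCISolution (p : ℕ) (Δt : ℝ) (U : Set V) (h : V → V) (Y : Fin (p + 1) → V) : Prop :=
  ∀ j : Fin p,
    trajectory p Y (gaussNode p j) ∈ U ∧
    (2 / Δt) • ∑ l : Fin p, ∑ k : Fin (p + 1),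
        (incidence p k l * (edgePoly p l).eval (gaussNode p j)) • Y k
      = h (trajectory p Y (gaussNode p j))

/-- A family of solutions of the equations of the mimetic canonical integrator, indexed by the
initial value `y ∈ W`. Its one-step map is `y ↦ Y y (Fin.last p)`. -/
def IsMCIFamily (p : ℕ) (Δt : ℝ) (U : Set V) (h : V → V) (W : Set V)
    (Y : V → Fin (p + 1) → V) : Prop :=
  ∀ y ∈ W, Y y 0 = y ∧ IsMCISolution p Δt U h (Y y)

/-! ### Runge–Kutta methods and Gauss collocation -/

/-- `y₁` is the result of one step of the `s`-stage Runge–Kutta method with coefficients `a`, `b`,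
started at `y₀`. -/
def IsRungeKuttaStep {s : ℕ} (a : Matrix (Fin s) (Fin s) ℝ) (b : Fin s → ℝ) (Δt : ℝ) (U : Set V)
    (h : V → V) (y₀ y₁ : V) : Prop :=
  ∃ κ : Fin s → V,
    (∀ i, y₀ + Δt • ∑ j, a i j • κ j ∈ U ∧ κ i = h (y₀ + Δt • ∑ j, a i j • κ j)) ∧
    y₁ = y₀ + Δt • ∑ i, b i • κ i

/-- The Gauss–Legendre nodes transported to `[0, 1]`. -/
def gaussC (p : ℕ) (i : Fin p) : ℝ := (gaussNode p i + 1) / 2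

/-- The coefficients `a_{ij} = ∫_0^{c_i} ℓ_j` of the Gauss method, where `ℓ_j` are the Lagrange
polynomials on the nodes `c_1, …, c_p`. -/
def gaussA (p : ℕ) : Matrix (Fin p) (Fin p) ℝ :=
  fun i j => ∫ x in (0 : ℝ)..gaussC p i, (Lagrange.basis Finset.univ (gaussC p) j).eval x

/-- The weights `b_j = ∫_0^1 ℓ_j` of the Gauss method. -/
def gaussB (p : ℕ) (j : Fin p) : ℝ :=
  ∫ x in (0 : ℝ)..1, (Lagrange.basis Finset.univ (gaussC p) j).eval x

/-- `y₁` is the result of one step of Gauss collocation started at `y₀`: a polynomial `u` of degree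
at most `p` in the rescaled time `s = (t - t₀) / Δt` satisfies `u(0) = y₀`, `u(1) = y₁`, and the
differential equation `du/ds = Δt h(u)` at `c_1, …, c_p`. -/
def IsGaussCollocationStep {M : ℕ} (p : ℕ) (Δt : ℝ) (U : Set (Fin M → ℝ))
    (h : (Fin M → ℝ) → (Fin M → ℝ)) (y₀ y₁ : Fin M → ℝ) : Prop :=
  ∃ u : Fin M → ℝ[X], (∀ m, (u m).natDegree ≤ p) ∧
    (fun m => (u m).eval 0) = y₀ ∧ (fun m => (u m).eval 1) = y₁ ∧
    ∀ i, (fun m => (u m).eval (gaussC p i)) ∈ U ∧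
      (fun m => (derivative (u m)).eval (gaussC p i))
        = Δt • h (fun m => (u m).eval (gaussC p i))

/-! ### Hamiltonian systems and symplectic maps -/

/-- The phase space `ℝ^{2n}`: `y (Sum.inl i) = q_i` and `y (Sum.inr i) = p_i`. -/
abbrev PhaseSpace (n : ℕ) : Type := Fin n ⊕ Fin n → ℝ

/-- The Hamiltonian vector field: `q_i' = ∂H/∂p_i`, `p_i' = -∂H/∂q_i`. -/
def hamiltonianField {n : ℕ} (H : PhaseSpace n → ℝ) (y : PhaseSpace n) : PhaseSpace n :=
  Sum.elim (fun i => fderiv ℝ H y (Pi.single (Sum.inr i) 1))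
    (fun i => -fderiv ℝ H y (Pi.single (Sum.inl i) 1))

/-- The symplectic form `ω = ∑_i dq_i ∧ dp_i`. -/
def symplecticForm {n : ℕ} (u v : PhaseSpace n) : ℝ :=
  ∑ i : Fin n, (u (Sum.inl i) * v (Sum.inr i) - u (Sum.inr i) * v (Sum.inl i))

/-- `Φ^* ω = ω` on `W`; to be used for a map `Φ` that is differentiable on the open set `W`. -/
def PreservesSymplecticForm {n : ℕ} (Φ : PhaseSpace n → PhaseSpace n) (W : Set (PhaseSpace n)) :
    Prop :=
  ∀ y ∈ W, ∀ u v, symplecticForm (fderiv ℝ Φ y u) (fderiv ℝ Φ y v) = symplecticForm u v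

/-- `Φ` is a symplectic map on the open set `W`: a smooth diffeomorphism from `W` onto an open set
that preserves the symplectic form. -/
structure IsSymplecticMapOn {n : ℕ} (Φ : PhaseSpace n → PhaseSpace n) (W : Set (PhaseSpace n)) :
    Prop where
  isOpen_source : IsOpen W
  isOpen_image : IsOpen (Φ '' W)
  contDiffOn : ContDiffOn ℝ ∞ Φ W
  exists_smooth_inverse : ∃ Ψ : PhaseSpace n → PhaseSpace n,
    ContDiffOn ℝ ∞ Ψ (Φ '' W) ∧ ∀ y ∈ W, Ψ (Φ y) = y
  preserves : PreservesSymplecticForm Φ W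

end

/-! ### Legendre polynomials: values at the end points and orthogonality -/

/-! The incidence matrix and the edge polynomials telescope (`sum_incidence_mul_edgePoly`), so the
MCI equations say that the curve `y_h`, of degree at most `p`, satisfies `y_h' = (Δt / 2) h(y_h)` at
the Gauss nodes. The scheme is Gauss collocation; the Lobatto nodes only provide coordinates on the
space of curves, and since they include `-1` and `1`, `y^0` and `y^p` are the end values.
Integrating the Lagrange interpolant of the derivative (`eval_derivative_eq_iff`) gives both the
Runge–Kutta form and a fixed-point form.

A bilinear expression in two such curves has degree at most `2p`. If its derivative vanishes at the
Gauss nodes, that derivative is `P_p q` with `deg q < p`, and orthogonality makes the end values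
equal (`eval_one_eq_eval_neg_one`, `bilinear_trajectory_conserved`). For a solution paired with
itself this conserves quadratic integrals. For `ω` and two variations of the solution in its initial
value it gives symplecticity, because the symmetry of the Hessian makes the linearised Hamiltonian
field infinitesimally symplectic.

For short steps the fixed-point map is a contraction, and the inverse function theorem gives a
smooth solution family with injective one-step map (`exists_isMCIFamily`). Since `ω` is
nondegenerate, an injective smooth map preserving it is a diffeomorphism onto an open set. -/

theorem eval_iterate_derivative_eq_factorial_mul_taylor_coeff (f : ℝ[X]) (a : ℝ) (k : ℕ) :
    (derivative^[k] f).eval a = (k.factorial : ℝ) * (taylor a f).coeff k := by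
  rw [taylor_coeff, ← factorial_smul_hasseDeriv]
  simp

/-- Centred at `a = ±1`, the factor `X ^ n` shows the order of vanishing, so all derivatives needed
at the end points can be read off from coefficients. -/
theorem taylor_X_sq_sub_one_pow (n : ℕ) {a : ℝ} (ha : a ^ 2 = 1) :
    taylor a ((X ^ 2 - 1 : ℝ[X]) ^ n) = X ^ n * (X + C (2 * a)) ^ n := by
  rw [taylor_apply, ← mul_pow, pow_comp]
  congr 1
  have h : (C a : ℝ[X]) ^ 2 = 1 := by rw [← C_pow, ha, C_1]
  simp only [sub_comp, pow_comp, X_comp, one_comp, C_mul, C_ofNat]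
  linear_combination h

theorem eval_iterate_derivative_X_sq_sub_one_pow_of_lt {n k : ℕ} (hk : k < n) {a : ℝ}
    (ha : a ^ 2 = 1) : (derivative^[k] ((X ^ 2 - 1 : ℝ[X]) ^ n)).eval a = 0 := by
  rw [eval_iterate_derivative_eq_factorial_mul_taylor_coeff, taylor_X_sq_sub_one_pow n ha,
    coeff_X_pow_mul', if_neg (by omega), mul_zero]

theorem legendrePoly_const_ne_zero (n : ℕ) : (1 / (2 ^ n * (n.factorial : ℝ))) ≠ 0 := by
  positivity

theorem legendrePoly_eval_ne_zero (n : ℕ) {a : ℝ} (ha : a ^ 2 = 1) :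
    (legendrePoly n).eval a ≠ 0 := by
  have ha0 : a ≠ 0 := by rintro rfl; norm_num at ha
  rw [legendrePoly, eval_mul, eval_C, eval_iterate_derivative_eq_factorial_mul_taylor_coeff,
    taylor_X_sq_sub_one_pow n ha, coeff_X_pow_mul', if_pos le_rfl, Nat.sub_self,
    coeff_zero_eq_eval_zero]
  have := legendrePoly_const_ne_zero n
  have h2 : (n.factorial : ℝ) ≠ 0 := by positivity
  refine mul_ne_zero this (mul_ne_zero h2 ?_)
  simpa using fun h => absurd h ha0

/-- Up to nonzero factors the value is the linear coefficient `n (2a)^(n-1)` of `(X + 2a)^n`. This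
separates the interior Lobatto nodes from `±1`. -/
theorem derivative_legendrePoly_eval_ne_zero {n : ℕ} (hn : 1 ≤ n) {a : ℝ} (ha : a ^ 2 = 1) :
    (derivative (legendrePoly n)).eval a ≠ 0 := by
  have ha0 : a ≠ 0 := by rintro rfl; norm_num at ha
  rw [legendrePoly, derivative_C_mul, ← Function.iterate_succ_apply' (f := derivative), eval_mul,
    eval_C, eval_iterate_derivative_eq_factorial_mul_taylor_coeff, taylor_X_sq_sub_one_pow n ha,
    coeff_X_pow_mul', if_pos (by omega), Nat.succ_sub (le_refl n), Nat.sub_self]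
  have h2 : ((n + 1).factorial : ℝ) ≠ 0 := by positivity
  have h3 : (n : ℝ) ≠ 0 := Nat.cast_ne_zero.mpr (by omega)
  refine mul_ne_zero (legendrePoly_const_ne_zero n) (mul_ne_zero h2 ?_)
  rw [coeff_X_add_C_pow]
  rw [Nat.choose_one_right]
  exact mul_ne_zero (pow_ne_zero _ (mul_ne_zero two_ne_zero ha0)) h3

theorem legendrePoly_natDegree_le (n : ℕ) : (legendrePoly n).natDegree ≤ n :=
  (natDegree_C_mul_le _ _).trans ((legendrePoly_natDegree_iterate_le n n).trans (by omega))

theorem legendrePoly_ne_zero (n : ℕ) : legendrePoly n ≠ 0 := by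
  intro h
  exact legendrePoly_eval_ne_zero n (a := 1) (by norm_num) (by simp [h])

theorem legendrePoly_natDegree (n : ℕ) : (legendrePoly n).natDegree = n := by
  refine le_antisymm (legendrePoly_natDegree_le n) ?_
  conv_lhs => rw [← legendrePoly_card_roots n]
  exact (Multiset.toFinset_card_le _).trans (card_roots' _)

/-- Repeated integration by parts: `q D^m f` has a primitive which vanishes wherever
`f, …, D^(m-1) f` do, if `q` has degree less than `m`. -/
theorem exists_derivative_eq_iterate_derivative_mul (f : ℝ[X]) (m : ℕ) :
    ∀ q : ℝ[X], derivative^[m] q = 0 → ∃ g : ℝ[X], derivative g = derivative^[m] f * q ∧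
      ∀ x, (∀ k < m, (derivative^[k] f).eval x = 0) → g.eval x = 0 := by
  induction m with
  | zero => intro q hq; exact ⟨0, by simp_all, by simp⟩
  | succ m ih =>
    intro q hq
    obtain ⟨g, hg, hx⟩ := ih (derivative q) hq
    refine ⟨derivative^[m] f * q - g, ?_, fun x h => ?_⟩
    · rw [derivative_sub, derivative_mul, hg, Function.iterate_succ_apply']
      ring
    · rw [eval_sub, eval_mul, h m (by omega), hx x fun k hk => h k (by omega)]
      ring

theorem eval_gaussNode (p : ℕ) (j : Fin p) : (legendrePoly p).eval (gaussNode p j) = 0 := by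
  have h := Finset.orderEmbOfFin_mem _ (legendrePoly_card_roots p) j
  rw [Multiset.mem_toFinset, mem_roots (legendrePoly_ne_zero p)] at h
  exact h

theorem gaussNode_injective (p : ℕ) : Function.Injective (gaussNode p) :=
  (Finset.orderEmbOfFin _ (legendrePoly_card_roots p)).injective

/-- Gauss quadrature with `p` nodes is exact on polynomials of degree less than `2 p`, in the form:
a primitive of a polynomial that vanishes at the Gauss nodes takes equal values at `1` and `-1`. -/
theorem eval_one_eq_eval_neg_one {p : ℕ} {r : ℝ[X]} (hr : r.natDegree ≤ 2 * p)
    (h : ∀ j, (derivative r).eval (gaussNode p j) = 0) : r.eval 1 = r.eval (-1) := by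
  have hP := legendrePoly_ne_zero p
  -- The remainder has degree below `p` and vanishes at the `p` distinct Gauss nodes.
  have hmod : derivative r % legendrePoly p = 0 := by
    refine eq_zero_of_degree_lt_of_eval_index_eq_zero (v := gaussNode p) Finset.univ
      (gaussNode_injective p).injOn ?_ fun j _ => ?_
    · refine (EuclideanDomain.mod_lt _ hP).trans_le ?_
      rw [degree_eq_natDegree hP, legendrePoly_natDegree]
      simp
    · have e := congrArg (eval (gaussNode p j))
        (EuclideanDomain.div_add_mod (derivative r) (legendrePoly p))
      rwa [eval_add, eval_mul, eval_gaussNode, zero_mul, zero_add, h j] at e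
  have hdiv := EuclideanDomain.div_add_mod (derivative r) (legendrePoly p)
  rw [hmod, add_zero] at hdiv
  set q := derivative r / legendrePoly p
  have hq : derivative^[p] (C (1 / (2 ^ p * (p.factorial : ℝ))) * q) = 0 := by
    rcases eq_or_ne q 0 with hq | hq
    · simp [hq]
    -- For `p = 0` the degree count does not give `deg q < p`, but then `r` is constant and `q = 0`.
    · rcases Nat.eq_zero_or_pos p with rfl | hp
      · exfalso
        have h0 : derivative r = 0 := by
          rw [natDegree_eq_zero.mp (by omega : r.natDegree = 0) |>.choose_spec.symm]; simp
        rw [h0] at hdiv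
        exact mul_ne_zero hP hq hdiv
      · refine iterate_derivative_eq_zero ((natDegree_C_mul_le _ _).trans_lt ?_)
        have e := congrArg natDegree hdiv
        rw [natDegree_mul hP hq, legendrePoly_natDegree] at e
        have := natDegree_derivative_le r
        omega
  -- Rodrigues' formula and integration by parts give a primitive `g` of `r'` vanishing at `±1`;
  -- hence `r` equals the constant `r - g` at both ends.
  obtain ⟨g, hg, hx⟩ :=
    exists_derivative_eq_iterate_derivative_mul ((X ^ 2 - 1 : ℝ[X]) ^ p) p _ hq
  have h0 : derivative (r - g) = 0 := by
    rw [derivative_sub, ← hdiv, hg, legendrePoly]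
    ring
  obtain ⟨c, hc⟩ := natDegree_eq_zero.mp (derivative_eq_zero.mp h0)
  have e (x : ℝ) (hx2 : x ^ 2 = 1) : r.eval x = c := by
    have := congrArg (eval x) hc
    rw [eval_C, eval_sub, hx x fun k hk =>
      eval_iterate_derivative_X_sq_sub_one_pow_of_lt hk hx2] at this
    linarith
  rw [e 1 (by norm_num), e (-1) (by norm_num)]

/-! ### The Gauss–Lobatto–Legendre nodes and the edge polynomials -/

theorem lobattoNode_zero (p : ℕ) : lobattoNode p 0 = -1 := by simp [lobattoNode]

theorem lobattoNode_last {p : ℕ} (hp : 1 ≤ p) : lobattoNode p (Fin.last p) = 1 := by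
  have h : Fin.last p ≠ 0 := by rw [Ne, Fin.ext_iff, Fin.val_last, Fin.val_zero]; omega
  simp [lobattoNode, h]

theorem eval_lobattoNode {p : ℕ} {i : Fin (p + 1)} (h0 : i ≠ 0) (h1 : i ≠ Fin.last p) :
    (derivative (legendrePoly p)).eval (lobattoNode p i) = 0 := by
  simp only [lobattoNode, h0, h1, dite_false]
  exact (mem_roots'.mp (Multiset.mem_toFinset.mp (Finset.orderEmbOfFin_mem _ _ _))).2

theorem lobattoNode_injective {p : ℕ} (hp : 1 ≤ p) : Function.Injective (lobattoNode p) := by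
  have hroot (i : Fin (p + 1)) (h0 : i ≠ 0) (h1 : i ≠ Fin.last p) :
      lobattoNode p i ≠ -1 ∧ lobattoNode p i ≠ 1 :=
    ⟨fun h => derivative_legendrePoly_eval_ne_zero hp (a := -1) (by norm_num)
      (h ▸ eval_lobattoNode h0 h1),
    fun h => derivative_legendrePoly_eval_ne_zero hp (a := 1) (by norm_num)
      (h ▸ eval_lobattoNode h0 h1)⟩
  have hl := lobattoNode_last hp
  have hz := lobattoNode_zero p
  intro i j hij
  by_cases hi0 : i = 0
  · subst hi0
    by_contra hj0
    by_cases hj1 : j = Fin.last p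
    · subst hj1; rw [hl, hz] at hij; norm_num at hij
    · exact (hroot j (Ne.symm hj0) hj1).1 (by rw [← hij, hz])
  by_cases hi1 : i = Fin.last p
  · subst hi1
    by_contra hj1
    by_cases hj0 : j = 0
    · subst hj0; rw [hl, hz] at hij; norm_num at hij
    · exact (hroot j hj0 (Ne.symm hj1)).2 (by rw [← hij, hl])
  by_cases hj0 : j = 0
  · subst hj0; exact absurd (hij.trans hz) (hroot i hi0 hi1).1
  by_cases hj1 : j = Fin.last p
  · subst hj1; exact absurd (hij.trans hl) (hroot i hi0 hi1).2
  simp only [lobattoNode, hi0, hi1, hj0, hj1, dite_false] at hij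
  have e := (Finset.orderEmbOfFin _ (legendrePoly_card_roots_derivative p)).injective hij
  have a := Fin.val_ne_iff.mpr hi0
  have b := Fin.val_ne_iff.mpr hj0
  simp only [Fin.mk.injEq, Fin.val_zero] at e a b
  exact Fin.ext (by omega)

theorem sum_primalBasis {p : ℕ} (hp : 1 ≤ p) : ∑ k, primalBasis p k = 1 :=
  Lagrange.sum_basis (lobattoNode_injective hp).injOn Finset.univ_nonempty

theorem eval_primalBasis {p : ℕ} (hp : 1 ≤ p) (i k : Fin (p + 1)) :
    (primalBasis p k).eval (lobattoNode p i) = if i = k then 1 else 0 := by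
  split_ifs with h
  · subst h
    exact Lagrange.eval_basis_self (lobattoNode_injective hp).injOn (Finset.mem_univ _)
  · exact Lagrange.eval_basis_of_ne (Ne.symm h) (Finset.mem_univ _)

theorem natDegree_primalBasis {p : ℕ} (hp : 1 ≤ p) (k : Fin (p + 1)) :
    (primalBasis p k).natDegree ≤ p := by
  refine natDegree_le_iff_degree_le.mpr ?_
  rw [primalBasis, Lagrange.degree_basis (lobattoNode_injective hp).injOn (Finset.mem_univ _)]
  simp

/-- Row `k` is the difference of two consecutive edge polynomials, whose partial sums differ by
`l_k'`. At the ends one edge is missing, but its partial sum would be empty, or the full sum, which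
vanishes because the `l_k` sum to `1`. -/
theorem sum_incidence_mul_edgePoly {p : ℕ} (hp : 1 ≤ p) (k : Fin (p + 1)) (τ : ℝ) :
    ∑ l, incidence p k l * (edgePoly p l).eval τ = (derivative (primalBasis p k)).eval τ := by
  set f : Fin (p + 1) → ℝ := fun k => (derivative (primalBasis p k)).eval τ with hf
  have hsum : ∑ k, f k = 0 := by
    rw [hf, ← eval_finsetSum, ← derivative_sum, sum_primalBasis hp]; simp
  have he (l : Fin p) : (edgePoly p l).eval τ = -∑ i ∈ Finset.Iic l.castSucc, f i := by
    rw [edgePoly, eval_neg, eval_finsetSum]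
  have hsplit (l : Fin p) : incidence p k l * (edgePoly p l).eval τ =
      (if k = l.succ then -∑ i ∈ Finset.Iio k, f i else 0) +
        (if k = l.castSucc then ∑ i ∈ Finset.Iic k, f i else 0) := by
    rw [he, incidence]
    by_cases h1 : k = l.succ
    · have h2 : k ≠ l.castSucc := by rw [h1]; exact (Fin.castSucc_lt_succ).ne'
      rw [if_pos h1, if_pos h1, if_neg h2, one_mul, add_zero, h1]
      congr 2
    · by_cases h2 : k = l.castSucc
      · rw [if_neg h1, if_pos h2, if_neg h1, if_pos h2, ← h2]; ring
      · simp [h1, h2]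
  simp_rw [hsplit]
  rw [Finset.sum_add_distrib]
  have hA : (∑ l : Fin p, if k = l.succ then -∑ i ∈ Finset.Iio k, f i else 0)
      = -∑ i ∈ Finset.Iio k, f i := by
    induction k using Fin.cases with
    | zero =>
      rw [Finset.sum_eq_zero fun l _ => if_neg (Fin.succ_ne_zero l).symm]
      have : Finset.Iio (0 : Fin (p + 1)) = ∅ := by ext; simp
      simp [this]
    | succ l => simp [Fin.succ_inj]
  have hB : (∑ l : Fin p, if k = l.castSucc then ∑ i ∈ Finset.Iic k, f i else 0)
      = ∑ i ∈ Finset.Iic k, f i := by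
    induction k using Fin.lastCases with
    | last =>
      rw [Finset.sum_eq_zero fun l _ => if_neg (Fin.castSucc_lt_last l).ne']
      have : Finset.Iic (Fin.last p) = Finset.univ := by ext i; simp [Fin.le_last]
      rw [this, hsum]
    | cast l => simp
  rw [hA, hB, ← Finset.Iio_insert, Finset.sum_insert (by simp)]
  ring

/-! ### The trajectory as a polynomial -/

theorem sum_incidence_edgePoly_smul {V : Type*} [AddCommGroup V] [Module ℝ V] {p : ℕ}
    (hp : 1 ≤ p) (Y : Fin (p + 1) → V) (τ : ℝ) :
    ∑ l : Fin p, ∑ k : Fin (p + 1), (incidence p k l * (edgePoly p l).eval τ) • Y k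
      = ∑ k, (derivative (primalBasis p k)).eval τ • Y k := by
  rw [Finset.sum_comm]
  exact Finset.sum_congr rfl fun k _ => by
    rw [← Finset.sum_smul, sum_incidence_mul_edgePoly hp]

/-- This is the collocation form on `[-1, 1]`, in which edges and incidences no longer appear. -/
theorem isMCISolution_iff {V : Type*} [AddCommGroup V] [Module ℝ V] {p : ℕ} (hp : 1 ≤ p)
    {Δt : ℝ} (hΔ : Δt ≠ 0) {U : Set V} {h : V → V} {Y : Fin (p + 1) → V} :
    IsMCISolution p Δt U h Y ↔ ∀ j : Fin p, trajectory p Y (gaussNode p j) ∈ U ∧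
      ∑ k, (derivative (primalBasis p k)).eval (gaussNode p j) • Y k
        = (Δt / 2) • h (trajectory p Y (gaussNode p j)) := by
  refine forall_congr' fun j => and_congr_right fun _ => ?_
  rw [sum_incidence_edgePoly_smul hp, ← inv_div Δt 2, inv_smul_eq_iff₀ (by simpa using hΔ)]

/-- The components of the trajectory with the nodal values `Y k`, as polynomials. -/
noncomputable def trajectoryPoly {ι : Type*} (p : ℕ) (Y : Fin (p + 1) → ι → ℝ) (m : ι) : ℝ[X] :=
  ∑ k, C (Y k m) * primalBasis p k

section TrajectoryPoly

variable {ι : Type*} {p : ℕ}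

theorem eval_trajectoryPoly (Y : Fin (p + 1) → ι → ℝ) (τ : ℝ) :
    (fun m => (trajectoryPoly p Y m).eval τ) = trajectory p Y τ := by
  ext m
  simp [trajectoryPoly, trajectory, eval_finsetSum, mul_comm]

theorem eval_derivative_trajectoryPoly (Y : Fin (p + 1) → ι → ℝ) (τ : ℝ) :
    (fun m => (derivative (trajectoryPoly p Y m)).eval τ)
      = ∑ k, (derivative (primalBasis p k)).eval τ • Y k := by
  ext m
  simp [trajectoryPoly, eval_finsetSum, mul_comm]

theorem natDegree_trajectoryPoly (hp : 1 ≤ p) (Y : Fin (p + 1) → ι → ℝ) (m : ι) :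
    (trajectoryPoly p Y m).natDegree ≤ p :=
  natDegree_sum_le_of_forall_le _ _ fun k _ =>
    (natDegree_C_mul_le _ _).trans (natDegree_primalBasis hp k)

theorem trajectory_lobattoNode {V : Type*} [AddCommGroup V] [Module ℝ V] (hp : 1 ≤ p)
    (Y : Fin (p + 1) → V) (i : Fin (p + 1)) : trajectory p Y (lobattoNode p i) = Y i := by
  simp [trajectory, eval_primalBasis hp]

theorem trajectory_neg_one {V : Type*} [AddCommGroup V] [Module ℝ V] (hp : 1 ≤ p)
    (Y : Fin (p + 1) → V) : trajectory p Y (-1) = Y 0 := by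
  rw [← lobattoNode_zero p, trajectory_lobattoNode hp]

theorem trajectory_one {V : Type*} [AddCommGroup V] [Module ℝ V] (hp : 1 ≤ p)
    (Y : Fin (p + 1) → V) : trajectory p Y 1 = Y (Fin.last p) := by
  rw [← lobattoNode_last hp, trajectory_lobattoNode hp]

/-- A polynomial of degree at most `p` is determined by its values at the Lobatto nodes. -/
theorem eq_of_eval_lobattoNode_eq (hp : 1 ≤ p) {f g : ℝ[X]} (hf : f.natDegree ≤ p)
    (hg : g.natDegree ≤ p) (h : ∀ i, f.eval (lobattoNode p i) = g.eval (lobattoNode p i)) :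
    f = g := by
  have hd {q : ℝ[X]} (hq : q.natDegree ≤ p) :
      q.degree < (Finset.univ : Finset (Fin (p + 1))).card := by
    refine (natDegree_le_iff_degree_le.mp hq).trans_lt ?_
    rw [Finset.card_univ, Fintype.card_fin]
    exact_mod_cast Nat.lt_succ_self p
  exact eq_of_degrees_lt_of_eval_index_eq (v := lobattoNode p) Finset.univ
    (lobattoNode_injective hp).injOn (hd hf) (hd hg) fun i _ => h i

theorem eq_trajectoryPoly (hp : 1 ≤ p) {u : ι → ℝ[X]} (hu : ∀ m, (u m).natDegree ≤ p) :
    u = trajectoryPoly p fun k m => (u m).eval (lobattoNode p k) := by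
  ext1 m
  refine eq_of_eval_lobattoNode_eq hp (hu m) (natDegree_trajectoryPoly hp _ m) fun i => ?_
  exact (congrFun ((eval_trajectoryPoly (fun k m => (u m).eval (lobattoNode p k)) _).trans
    (trajectory_lobattoNode hp _ i)) m).symm

/-- Bilinear forms of two polynomial curves of degree at most `p` are conserved if their derivative
vanishes at the Gauss nodes. -/
theorem bilinear_trajectory_conserved [Fintype ι] (hp : 1 ≤ p) (S : Matrix ι ι ℝ)
    (Y Z : Fin (p + 1) → ι → ℝ)
    (h : ∀ j : Fin p,
      (∑ k, (derivative (primalBasis p k)).eval (gaussNode p j) • Y k) ⬝ᵥ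
          S.mulVec (trajectory p Z (gaussNode p j)) +
        trajectory p Y (gaussNode p j) ⬝ᵥ
          S.mulVec (∑ k, (derivative (primalBasis p k)).eval (gaussNode p j) • Z k) = 0) :
    Y (Fin.last p) ⬝ᵥ S.mulVec (Z (Fin.last p)) = Y 0 ⬝ᵥ S.mulVec (Z 0) := by
  -- The bilinear form along the two curves, as a polynomial: its degree bound `2p` is the one that
  -- `eval_one_eq_eval_neg_one` allows.
  set r : ℝ[X] := ∑ i, ∑ j, C (S i j) * (trajectoryPoly p Y i * trajectoryPoly p Z j) with hr
  have hform (u v : ι → ℝ) : u ⬝ᵥ S.mulVec v = ∑ i, ∑ j, S i j * (u i * v j) := by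
    simp only [dotProduct, Matrix.mulVec, Finset.mul_sum]
    exact Finset.sum_congr rfl fun i _ => Finset.sum_congr rfl fun j _ => by ring
  have heval (τ : ℝ) : r.eval τ = trajectory p Y τ ⬝ᵥ S.mulVec (trajectory p Z τ) := by
    rw [hform, hr, ← eval_trajectoryPoly, ← eval_trajectoryPoly]
    simp [eval_finsetSum]
  have hdeg : r.natDegree ≤ 2 * p := by
    refine natDegree_sum_le_of_forall_le _ _ fun i _ => natDegree_sum_le_of_forall_le _ _
      fun j _ => (natDegree_C_mul_le _ _).trans (natDegree_mul_le.trans ?_)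
    have h1 := natDegree_trajectoryPoly hp Y i
    have h2 := natDegree_trajectoryPoly hp Z j
    omega
  have hder (j : Fin p) : (derivative r).eval (gaussNode p j) = 0 := by
    rw [← h j, ← eval_derivative_trajectoryPoly, ← eval_derivative_trajectoryPoly,
      ← eval_trajectoryPoly, ← eval_trajectoryPoly, hform, hform, hr]
    simp only [derivative_sum, derivative_mul, derivative_C, eval_finsetSum, eval_mul, eval_add,
      eval_C, ← Finset.sum_add_distrib, zero_mul, zero_add, mul_add]
  have e := eval_one_eq_eval_neg_one hdeg hder
  rwa [heval, heval, trajectory_one hp, trajectory_one hp, trajectory_neg_one hp,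
    trajectory_neg_one hp] at e

theorem IsMCISolution.quadratic_conserved [Fintype ι] (hp : 1 ≤ p) {Δt : ℝ} (hΔ : Δt ≠ 0)
    {U : Set (ι → ℝ)} {h : (ι → ℝ) → ι → ℝ} {S : Matrix ι ι ℝ} (hS : S.IsSymm)
    (hU : ∀ y ∈ U, y ⬝ᵥ S.mulVec (h y) = 0) {Y : Fin (p + 1) → ι → ℝ}
    (hY : IsMCISolution p Δt U h Y) :
    Y (Fin.last p) ⬝ᵥ S.mulVec (Y (Fin.last p)) = Y 0 ⬝ᵥ S.mulVec (Y 0) := by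
  refine bilinear_trajectory_conserved hp S Y Y fun j => ?_
  obtain ⟨hj, e⟩ := (isMCISolution_iff hp hΔ).mp hY j
  have hz := hU _ hj
  have hsymm (a b : ι → ℝ) : a ⬝ᵥ S.mulVec b = b ⬝ᵥ S.mulVec a := by
    rw [Matrix.dotProduct_mulVec, ← Matrix.mulVec_transpose, hS.eq, dotProduct_comm]
  rw [hsymm, e, Matrix.mulVec_smul, dotProduct_smul, hz]
  simp

end TrajectoryPoly

/-! ### Hamiltonian vector fields -/

section Hamiltonian

variable {n : ℕ}

theorem symplecticForm_eq_dotProduct (u v : PhaseSpace n) :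
    symplecticForm u v = u ⬝ᵥ (Matrix.fromBlocks 0 1 (-1) 0).mulVec v := by
  simp [symplecticForm, dotProduct, Matrix.fromBlocks_mulVec, Fintype.sum_sum_type,
    Matrix.neg_mulVec, sub_eq_add_neg, Finset.sum_add_distrib]

/-- The vector field dual to a linear form with respect to the symplectic form. -/
noncomputable def symplecticDual (n : ℕ) : (PhaseSpace n →L[ℝ] ℝ) →L[ℝ] PhaseSpace n :=
  ContinuousLinearMap.pi (Sum.elim
    (fun i => ContinuousLinearMap.apply ℝ ℝ (Pi.single (Sum.inr i) 1))
    (fun i => -ContinuousLinearMap.apply ℝ ℝ (Pi.single (Sum.inl i) 1)))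

theorem hamiltonianField_eq (H : PhaseSpace n → ℝ) :
    hamiltonianField H = fun y => symplecticDual n (fderiv ℝ H y) := by
  ext y (i | i) <;> simp [hamiltonianField, symplecticDual]

theorem symplecticForm_symplecticDual_left (φ : PhaseSpace n →L[ℝ] ℝ) (v : PhaseSpace n) :
    symplecticForm (symplecticDual n φ) v = φ v := by
  conv_rhs => rw [pi_eq_sum_univ' v, map_sum]
  simp [symplecticForm, symplecticDual, Fintype.sum_sum_type, Finset.sum_add_distrib, mul_comm,
    add_comm]

theorem symplecticForm_swap (u v : PhaseSpace n) : symplecticForm u v = -symplecticForm v u := by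
  rw [symplecticForm, symplecticForm, ← Finset.sum_neg_distrib]
  exact Finset.sum_congr rfl fun i _ => by ring

theorem contDiffAt_hamiltonianField {H : PhaseSpace n → ℝ} {z : PhaseSpace n}
    (hH : ContDiffAt ℝ ∞ H z) : ContDiffAt ℝ ∞ (hamiltonianField H) z := by
  rw [hamiltonianField_eq]
  exact (symplecticDual n).contDiff.contDiffAt.comp z (hH.fderiv_right (m := ∞) (by simp))

/-- Contracting the linearised field with `ω` leaves the Hessian of `H`; the two terms are `H''(a,
b)` and `-H''(b, a)`. -/
theorem symplecticForm_fderiv_hamiltonianField {H : PhaseSpace n → ℝ} {z : PhaseSpace n}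
    (hH : ContDiffAt ℝ ∞ H z) (a b : PhaseSpace n) :
    symplecticForm (fderiv ℝ (hamiltonianField H) z a) b +
      symplecticForm a (fderiv ℝ (hamiltonianField H) z b) = 0 := by
  have hd : DifferentiableAt ℝ (fderiv ℝ H) z :=
    (hH.fderiv_right (m := 1) (by norm_cast)).differentiableAt one_ne_zero
  have hf : fderiv ℝ (hamiltonianField H) z =
      (symplecticDual n).comp (fderiv ℝ (fderiv ℝ H) z) := by
    rw [hamiltonianField_eq]
    exact ((symplecticDual n).hasFDerivAt.comp z hd.hasFDerivAt).fderiv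
  have hs : IsSymmSndFDerivAt ℝ H z := hH.isSymmSndFDerivAt (by simp; norm_cast)
  rw [symplecticForm_swap a, hf, ContinuousLinearMap.comp_apply, ContinuousLinearMap.comp_apply,
    symplecticForm_symplecticDual_left, symplecticForm_symplecticDual_left, hs.eq a b]
  ring

end Hamiltonian

/-! ### One-step maps preserve the symplectic form -/

/-- The linear combination with coefficients `c` of the nodal values. -/
noncomputable def nodalCombination {V : Type*} [NormedAddCommGroup V] [NormedSpace ℝ V] {p : ℕ}
    (c : Fin (p + 1) → ℝ) : (Fin (p + 1) → V) →L[ℝ] V :=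
  ∑ k, c k • ContinuousLinearMap.proj k

theorem nodalCombination_apply {V : Type*} [NormedAddCommGroup V] [NormedSpace ℝ V] {p : ℕ}
    (c : Fin (p + 1) → ℝ) (Y : Fin (p + 1) → V) : nodalCombination c Y = ∑ k, c k • Y k := by
  simp [nodalCombination]

/-- The variations `D u` and `D v` are themselves nodal values of curves of degree at most `p`, and
they satisfy the linearised equations at the Gauss nodes. So `ω` of the two curves is conserved from
`-1` to `1`. -/
theorem IsMCIFamily.preservesSymplecticForm {p : ℕ} (hp : 1 ≤ p) {n : ℕ}
    {U : Set (PhaseSpace n)} {H : PhaseSpace n → ℝ} (hU : IsOpen U) (hH : ContDiffOn ℝ ∞ H U)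
    {Δt : ℝ} {W : Set (PhaseSpace n)} {Y : PhaseSpace n → Fin (p + 1) → PhaseSpace n}
    (hΔ : Δt ≠ 0) (hW : IsOpen W) (hY : IsMCIFamily p Δt U (hamiltonianField H) W Y)
    (hd : DifferentiableOn ℝ Y W) : PreservesSymplecticForm (fun y => Y y (Fin.last p)) W := by
  intro y hy u v
  have hWy : W ∈ nhds y := hW.mem_nhds hy
  have hD := (hd.differentiableAt hWy).hasFDerivAt
  set D := fderiv ℝ Y y
  have hlast : fderiv ℝ (fun y => Y y (Fin.last p)) y =
      (ContinuousLinearMap.proj (Fin.last p)).comp D :=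
    ((ContinuousLinearMap.proj (R := ℝ) (φ := fun _ : Fin (p + 1) => PhaseSpace n)
      (Fin.last p)).hasFDerivAt.comp y hD).fderiv
  -- Differentiate `Y z 0 = z`, which holds on the open set `W`.
  have hzero (w : PhaseSpace n) : D w 0 = w := by
    have h1 := (ContinuousLinearMap.proj (R := ℝ) (φ := fun _ : Fin (p + 1) => PhaseSpace n)
      0).hasFDerivAt.comp y hD
    have h2 := (hasFDerivAt_id (𝕜 := ℝ) y).congr_of_eventuallyEq
      (f₁ := (ContinuousLinearMap.proj (R := ℝ) (φ := fun _ : Fin (p + 1) => PhaseSpace n) 0) ∘ Y)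
      (Filter.eventuallyEq_of_mem hWy fun z hz => (hY z hz).1)
    exact DFunLike.congr_fun (h1.unique h2) w
  -- Both sides of the collocation equation agree near `y`, so their derivatives agree.
  have hlin (j : Fin p) (w : PhaseSpace n) :
      ∑ k, (derivative (primalBasis p k)).eval (gaussNode p j) • D w k = (Δt / 2) •
        fderiv ℝ (hamiltonianField H) (trajectory p (Y y) (gaussNode p j))
          (trajectory p (D w) (gaussNode p j)) := by
    have hz := ((isMCISolution_iff hp hΔ).mp (hY y hy).2 j).1
    have hf := ((contDiffAt_hamiltonianField (hH.contDiffAt (hU.mem_nhds hz))).differentiableAt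
      (by simp)).hasFDerivAt
    have hT (Z : Fin (p + 1) → PhaseSpace n) : trajectory p Z (gaussNode p j) =
        nodalCombination (fun k => (primalBasis p k).eval (gaussNode p j)) Z :=
      (nodalCombination_apply _ _).symm
    rw [hT] at hf
    have h1 := (nodalCombination (V := PhaseSpace n) fun k : Fin (p + 1) =>
      (derivative (primalBasis p k)).eval (gaussNode p j)).hasFDerivAt.comp y hD
    have h2 := (hf.comp y ((nodalCombination (V := PhaseSpace n) fun k : Fin (p + 1) =>
      (primalBasis p k).eval (gaussNode p j)).hasFDerivAt.comp y hD)).const_smul (Δt / 2)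
    have h3 := h1.congr_of_eventuallyEq (f₁ := (Δt / 2) • hamiltonianField H ∘
      ⇑(nodalCombination fun k => (primalBasis p k).eval (gaussNode p j)) ∘ Y)
      (Filter.eventuallyEq_of_mem hWy fun z hz => by
      have e := ((isMCISolution_iff hp hΔ).mp (hY z hz).2 j).2
      rw [hT, ← nodalCombination_apply] at e
      exact e.symm)
    have e := DFunLike.congr_fun (h3.unique h2) w
    rw [hT, hT, ← nodalCombination_apply]
    exact e
  rw [hlast]
  simp only [ContinuousLinearMap.comp_apply, ContinuousLinearMap.proj_apply]
  rw [symplecticForm_eq_dotProduct, bilinear_trajectory_conserved hp, hzero, hzero,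
    symplecticForm_eq_dotProduct]
  intro j
  have hz := ((isMCISolution_iff hp hΔ).mp (hY y hy).2 j).1
  have e := symplecticForm_fderiv_hamiltonianField (hH.contDiffAt (hU.mem_nhds hz))
    (trajectory p (D u) (gaussNode p j)) (trajectory p (D v) (gaussNode p j))
  rw [symplecticForm_eq_dotProduct, symplecticForm_eq_dotProduct] at e
  rw [hlin, hlin, Matrix.mulVec_smul, smul_dotProduct, dotProduct_smul, ← smul_add, e, smul_zero]

/-! ### Smooth inverses -/

section Inverse

variable {E : Type*} [NormedAddCommGroup E] [NormedSpace ℝ E] [FiniteDimensional ℝ E]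

theorem isOpen_image_and_contDiffOn_invFunOn {f : E → E} {W : Set E} (hW : IsOpen W)
    (hf : ContDiffOn ℝ ∞ f W) (hinj : Set.InjOn f W)
    (hd : ∀ y ∈ W, Function.Injective (fderiv ℝ f y)) :
    IsOpen (f '' W) ∧ ContDiffOn ℝ ∞ (Function.invFunOn f W) (f '' W) := by
  have : CompleteSpace E := FiniteDimensional.complete ℝ E
  have key (y : E) (hy : y ∈ W) :
      f '' W ∈ nhds (f y) ∧ ContDiffAt ℝ ∞ (Function.invFunOn f W) (f y) := by
    have hc := hf.contDiffAt (hW.mem_nhds hy)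
    let e : E ≃L[ℝ] E :=
      (LinearEquiv.ofInjectiveEndo (fderiv ℝ f y).toLinearMap (hd y hy)).toContinuousLinearEquiv
    have he : HasFDerivAt f (e : E →L[ℝ] E) y := by
      have h := (hc.differentiableAt (by simp)).hasFDerivAt
      have h2 : (e : E →L[ℝ] E) = fderiv ℝ f y := by ext v; rfl
      rwa [h2]
    have hs := hc.hasStrictFDerivAt' he (by simp)
    refine ⟨?_, (hc.to_localInverse he (by simp)).congr_of_eventuallyEq ?_⟩
    · rw [← hs.map_nhds_eq_of_equiv]
      exact Filter.image_mem_map (hW.mem_nhds hy)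
    -- The local inverse takes values in `W` near `f y`, so injectivity on `W` identifies it with
    -- `invFunOn`.
    · have h1 := hs.eventually_right_inverse
      have h2 := hs.localInverse_tendsto.eventually (hW.mem_nhds hy)
      filter_upwards [h1, h2] with z hz1 hz2
      have hz : ∃ a ∈ W, f a = z := ⟨_, hz2, hz1⟩
      exact hinj (Function.invFunOn_mem hz) hz2 ((Function.invFunOn_eq hz).trans hz1.symm)
  refine ⟨isOpen_iff_mem_nhds.mpr ?_, ?_⟩
  · rintro _ ⟨y, hy, rfl⟩
    exact (key y hy).1
  · rintro _ ⟨y, hy, rfl⟩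
    exact (key y hy).2.contDiffWithinAt

/-- The equation `z - F z = w` for a contraction `F` on a ball has a unique solution, which depends
smoothly on `w` near the centre if `F` is smooth and small there. -/
theorem exists_contDiffOn_solution {F : E → E} {b : E} {r : ℝ} (hr : 0 < r)
    (hF : ContDiffOn ℝ ∞ F (Metric.ball b r)) (hL : LipschitzOnWith (1 / 4) F (Metric.ball b r))
    (hb : ‖F b‖ ≤ r / 8) :
    ∃ Θ : E → E, ContDiffOn ℝ ∞ Θ (Metric.ball b (r / 8)) ∧
      (∀ w ∈ Metric.ball b (r / 8), Θ w ∈ Metric.ball b r ∧ Θ w - F (Θ w) = w) ∧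
      ∀ w, ∀ z ∈ Metric.ball b r, z - F z = w → z = Θ w := by
  have : CompleteSpace E := FiniteDimensional.complete ℝ E
  set G : E → E := fun z => z - F z with hG
  have hinj : Set.InjOn G (Metric.ball b r) := by
    intro z hz z' hz' h
    have h1 := hL.norm_sub_le hz hz'
    have h2 : F z - F z' = z - z' := by
      simp only [hG] at h
      rw [sub_eq_sub_iff_sub_eq_sub] at h
      exact h.symm
    rw [h2] at h1
    have h3 : ‖z - z'‖ ≤ 0 := by
      have : ((1 / 4 : NNReal) : ℝ) = 1 / 4 := by norm_num
      rw [this] at h1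
      linarith
    exact sub_eq_zero.mp (norm_le_zero_iff.mp h3)
  have hd (y : E) (hy : y ∈ Metric.ball b r) : Function.Injective (fderiv ℝ G y) := by
    have hy' := Metric.isOpen_ball.mem_nhds hy
    have h1 := (hF.contDiffAt hy').differentiableAt (by simp)
    have h2 : fderiv ℝ G y = ContinuousLinearMap.id ℝ E - fderiv ℝ F y :=
      ((hasFDerivAt_id y).sub h1.hasFDerivAt).fderiv
    have h3 := norm_fderiv_le_of_lipschitzOn ℝ hy' hL
    rw [injective_iff_map_eq_zero]
    intro v hv
    rw [h2, sub_apply, ContinuousLinearMap.id_apply, sub_eq_zero] at hv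
    have h4 := (fderiv ℝ F y).le_of_opNorm_le h3 v
    rw [← hv] at h4
    have : ((1 / 4 : NNReal) : ℝ) = 1 / 4 := by norm_num
    rw [this] at h4
    exact norm_le_zero_iff.mp (by linarith)
  have hsm := (isOpen_image_and_contDiffOn_invFunOn Metric.isOpen_ball (contDiffOn_id.sub hF)
    hinj hd).2
  have hA : ApproximatesLinearOn G (ContinuousLinearMap.id ℝ E) (Metric.ball b r) (1 / 4) := by
    intro z hz z' hz'
    have h1 := hL.norm_sub_le hz hz'
    have h2 : G z - G z' - ContinuousLinearMap.id ℝ E (z - z') = -(F z - F z') := by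
      simp only [hG, ContinuousLinearMap.id_apply]; abel
    rwa [h2, norm_neg]
  have hsurj (w : E) (hw : w ∈ Metric.ball b (r / 8)) : ∃ z ∈ Metric.ball b r, G z = w := by
    -- The image of this closed ball covers the ball of radius `(1 - 1/4) r/2 = 3r/8` about `G b`,
    -- and `w` lies within `r/8 + r/8` of `G b`.
    have hsub : Metric.closedBall b (r / 2) ⊆ Metric.ball b r :=
      Metric.closedBall_subset_ball (by linarith)
    obtain ⟨z, hz, e⟩ := hA.surjOn_closedBall_of_nonlinearRightInverse
      ⟨id, 1, fun y => by simp, fun y => rfl⟩ (by linarith : 0 ≤ r / 2) hsub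
      (show w ∈ _ by
        have h1 : ‖w - b‖ < r / 8 := by rwa [← dist_eq_norm]
        have h2 : w - G b = (w - b) + F b := by simp only [hG]; abel
        rw [Metric.mem_closedBall, dist_eq_norm, h2]
        refine (norm_add_le _ _).trans ?_
        norm_num
        linarith)
    exact ⟨z, hsub hz, e⟩
  refine ⟨Function.invFunOn G (Metric.ball b r), hsm.mono hsurj, fun w hw =>
    ⟨Function.invFunOn_mem (hsurj w hw), Function.invFunOn_eq (hsurj w hw)⟩, fun w z hz e => ?_⟩
  have hw : ∃ a ∈ Metric.ball b r, G a = w := ⟨z, hz, e⟩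
  exact hinj hz (Function.invFunOn_mem hw) (e.trans (Function.invFunOn_eq hw).symm)

end Inverse

/-- A vector killed by the derivative of `Φ` is `ω`-orthogonal to everything, hence zero by
nondegeneracy; the inverse function theorem does the rest. -/
theorem isSymplecticMapOn_of_injOn {n : ℕ} {Φ : PhaseSpace n → PhaseSpace n}
    {W : Set (PhaseSpace n)} (hW : IsOpen W) (hΦ : ContDiffOn ℝ ∞ Φ W) (hinj : Set.InjOn Φ W)
    (hω : PreservesSymplecticForm Φ W) : IsSymplecticMapOn Φ W := by
  have hd (y : PhaseSpace n) (hy : y ∈ W) : Function.Injective (fderiv ℝ Φ y) := by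
    rw [injective_iff_map_eq_zero]
    intro u hu
    have h (v : PhaseSpace n) : symplecticForm u v = 0 := by
      rw [← hω y hy, hu]; simp [symplecticForm]
    ext (i | i)
    · simpa [symplecticForm, Pi.single_apply] using h (Pi.single (Sum.inr i) 1)
    · simpa [symplecticForm, Pi.single_apply] using h (Pi.single (Sum.inl i) 1)
  obtain ⟨ho, hs⟩ := isOpen_image_and_contDiffOn_invFunOn hW hΦ hinj hd
  exact ⟨hW, ho, hΦ, ⟨_, hs, fun y hy => hinj.leftInvOn_invFunOn hy⟩, hω⟩

/-! ### Primitives of the Lagrange polynomials -/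

theorem exists_derivative_eq (f : ℝ[X]) (a : ℝ) :
    ∃ g : ℝ[X], derivative g = f ∧ g.eval a = 0 := by
  obtain ⟨g, hg⟩ : ∃ g : ℝ[X], derivative g = f := by
    induction f using Polynomial.induction_on' with
    | add f g hf hg =>
      obtain ⟨F, rfl⟩ := hf
      obtain ⟨G, rfl⟩ := hg
      exact ⟨F + G, derivative_add⟩
    | monomial n c =>
      refine ⟨monomial (n + 1) (c / (n + 1)), ?_⟩
      rw [derivative_monomial]
      have : (n + 1 : ℝ) ≠ 0 := by positivity
      simp [this]
  exact ⟨g - C (g.eval a), by simp [hg], by simp⟩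

/-- The primitive, vanishing at `a`, of the Lagrange polynomial number `j` on the nodes `c`. -/
noncomputable def lagrangePrimitive {s : ℕ} (c : Fin s → ℝ) (a : ℝ) (j : Fin s) : ℝ[X] :=
  (exists_derivative_eq (Lagrange.basis Finset.univ c j) a).choose

section LagrangePrimitive

variable {s : ℕ} {c : Fin s → ℝ}

theorem derivative_lagrangePrimitive (c : Fin s → ℝ) (a : ℝ) (j : Fin s) :
    derivative (lagrangePrimitive c a j) = Lagrange.basis Finset.univ c j :=
  (exists_derivative_eq (Lagrange.basis Finset.univ c j) a).choose_spec.1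

theorem eval_lagrangePrimitive_self (c : Fin s → ℝ) (a : ℝ) (j : Fin s) :
    (lagrangePrimitive c a j).eval a = 0 :=
  (exists_derivative_eq (Lagrange.basis Finset.univ c j) a).choose_spec.2

theorem integral_lagrange_basis (c : Fin s → ℝ) (a b : ℝ) (j : Fin s) :
    ∫ x in a..b, (Lagrange.basis Finset.univ c j).eval x = (lagrangePrimitive c a j).eval b := by
  rw [intervalIntegral.integral_eq_sub_of_hasDerivAt
    (f := fun x => (lagrangePrimitive c a j).eval x)
    (fun x _ => ?_) ((Polynomial.continuous _).intervalIntegrable _ _),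
    eval_lagrangePrimitive_self, sub_zero]
  rw [← derivative_lagrangePrimitive c a j]
  exact Polynomial.hasDerivAt _ _

theorem natDegree_lagrangePrimitive (hc : Function.Injective c) (a : ℝ) (j : Fin s) :
    (lagrangePrimitive c a j).natDegree ≤ s := by
  have h1 := natDegree_derivative (lagrangePrimitive c a j)
  have h2 : (Lagrange.basis Finset.univ c j).natDegree = s - 1 := by
    refine natDegree_eq_of_degree_eq_some ?_
    rw [Lagrange.degree_basis hc.injOn (Finset.mem_univ _)]
    simp
  rw [derivative_lagrangePrimitive, h2] at h1
  -- This supplies `1 ≤ s`, without which the truncated `s - 1` would lose information.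
  have := j.isLt
  omega

theorem natDegree_add_sum_lagrangePrimitive (hc : Function.Injective c) (a y : ℝ) (w : Fin s → ℝ) :
    (C y + ∑ j, C (w j) * lagrangePrimitive c a j).natDegree ≤ s :=
  natDegree_add_le_of_degree_le (by simp) (natDegree_sum_le_of_forall_le _ _ fun j _ =>
    (natDegree_C_mul_le _ _).trans (natDegree_lagrangePrimitive hc a j))

/-- The derivative has degree below `s`, so it is its own interpolant at the `s` nodes; integrate
from `a`. -/
theorem eval_derivative_eq_iff (hs : 1 ≤ s) (hc : Function.Injective c) (a : ℝ) {u : ℝ[X]}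
    (hu : u.natDegree ≤ s) (w : Fin s → ℝ) :
    (∀ j, (derivative u).eval (c j) = w j) ↔
      u = C (u.eval a) + ∑ j, C (w j) * lagrangePrimitive c a j := by
  set q : ℝ[X] := C (u.eval a) + ∑ j, C (w j) * lagrangePrimitive c a j with hq
  have hqd (i : Fin s) : (derivative q).eval (c i) = w i := by
    simp only [hq, derivative_add, derivative_C, derivative_sum, derivative_C_mul,
      derivative_lagrangePrimitive, zero_add, eval_finsetSum, eval_mul, eval_C]
    rw [Finset.sum_eq_single i, Lagrange.eval_basis_self hc.injOn (Finset.mem_univ _), mul_one]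
    · intro j _ hj
      rw [Lagrange.eval_basis_of_ne hj (Finset.mem_univ _), mul_zero]
    · simp
  constructor
  · intro h
    have hdeg {f : ℝ[X]} (hf : f.natDegree ≤ s) :
        (derivative f).degree < (Finset.univ : Finset (Fin s)).card := by
      rw [Finset.card_univ, Fintype.card_fin]
      refine (degree_le_natDegree).trans_lt ?_
      have := natDegree_derivative_le f
      exact_mod_cast (by omega : (derivative f).natDegree < s)
    have e : derivative u = derivative q :=
      eq_of_degrees_lt_of_eval_index_eq (v := c) Finset.univ hc.injOn (hdeg hu)
        (hdeg (natDegree_add_sum_lagrangePrimitive hc a _ w)) fun j _ => (h j).trans (hqd j).symm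
    obtain ⟨d, hd⟩ := natDegree_eq_zero.mp
      (derivative_eq_zero.mp (by rw [derivative_sub, e, sub_self] : derivative (u - q) = 0))
    have hqa : q.eval a = u.eval a := by
      simp [hq, eval_finsetSum, eval_lagrangePrimitive_self]
    have h0 : d = 0 := by
      have := congrArg (eval a) hd
      simpa [hqa] using this
    rw [h0, C_0] at hd
    exact (sub_eq_zero.mp hd.symm)
  · intro h j
    rw [h, hqd]

end LagrangePrimitive

/-! ### The Gauss method -/

theorem gaussC_injective (p : ℕ) : Function.Injective (gaussC p) := fun i j h =>
  gaussNode_injective p (by simp only [gaussC] at h; linarith)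

theorem gaussA_eq (p : ℕ) (i j : Fin p) :
    gaussA p i j = (lagrangePrimitive (gaussC p) 0 j).eval (gaussC p i) :=
  integral_lagrange_basis _ _ _ _

theorem gaussB_eq (p : ℕ) (j : Fin p) :
    gaussB p j = (lagrangePrimitive (gaussC p) 0 j).eval 1 :=
  integral_lagrange_basis _ _ _ _

theorem sum_gaussA {p : ℕ} (hp : 1 ≤ p) (i : Fin p) : ∑ j, gaussA p i j = gaussC p i := by
  have h := (eval_derivative_eq_iff hp (gaussC_injective p) 0 (u := X) (by simpa using hp)
    fun _ => 1).mp (by simp)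
  have e := congrArg (eval (gaussC p i)) h
  simp only [eval_X, C_0, zero_add, C_1, one_mul, eval_finsetSum] at e
  simp_rw [gaussA_eq]
  exact e.symm

/-- Otherwise the whole first row vanishes, so its sum `c_1` is `0` and `-1` is a Gauss node,
contradicting `P_p(-1) ≠ 0`. -/
theorem exists_gaussA_ne_zero {p : ℕ} (hp : 1 ≤ p) : ∃ i j : Fin p, i ≤ j ∧ gaussA p i j ≠ 0 := by
  by_contra! h
  have h0 := sum_gaussA hp ⟨0, hp⟩
  rw [Finset.sum_eq_zero fun j _ => h _ j (Fin.le_def.mpr (Nat.zero_le _)), gaussC] at h0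
  refine legendrePoly_eval_ne_zero p (a := -1) (by norm_num) ?_
  rw [show (-1 : ℝ) = gaussNode p ⟨0, hp⟩ by linarith, eval_gaussNode]

theorem isGaussCollocationStep_iff_isRungeKuttaStep {M p : ℕ} (hp : 1 ≤ p) {Δt : ℝ}
    {U : Set (Fin M → ℝ)} {h : (Fin M → ℝ) → Fin M → ℝ} {y₀ y₁ : Fin M → ℝ} :
    IsGaussCollocationStep p Δt U h y₀ y₁ ↔
      IsRungeKuttaStep (gaussA p) (gaussB p) Δt U h y₀ y₁ := by
  have heval (κ : Fin p → Fin M → ℝ) (x : ℝ) :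
      (fun m => (C (y₀ m) + ∑ j, C (Δt * κ j m) * lagrangePrimitive (gaussC p) 0 j).eval x) =
        y₀ + Δt • ∑ j, (lagrangePrimitive (gaussC p) 0 j).eval x • κ j := by
    ext m
    simp only [eval_add, eval_C, eval_finsetSum, eval_mul, Pi.add_apply, Pi.smul_apply,
      Finset.sum_apply, smul_eq_mul, Finset.mul_sum]
    exact congrArg _ (Finset.sum_congr rfl fun j _ => by ring)
  constructor
  · rintro ⟨u, hu, h0, h1, hc⟩
    -- The stage slopes are the field along the collocation polynomial, whose values at the `c_i`
    -- become the stage points.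
    refine ⟨fun j => h fun m => (u m).eval (gaussC p j), ?_⟩
    set κ : Fin p → Fin M → ℝ := fun j => h fun m => (u m).eval (gaussC p j)
    have e : u = fun m => C (y₀ m) + ∑ j, C (Δt * κ j m) * lagrangePrimitive (gaussC p) 0 j := by
      ext1 m
      rw [← h0]
      exact (eval_derivative_eq_iff hp (gaussC_injective p) 0 (hu m) _).mp
        fun j => congrFun (hc j).2 m
    have hx (x : ℝ) : (fun m => (u m).eval x) =
        y₀ + Δt • ∑ j, (lagrangePrimitive (gaussC p) 0 j).eval x • κ j := by
      rw [← heval κ x, e]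
    have hy (i : Fin p) : y₀ + Δt • ∑ j, gaussA p i j • κ j =
        fun m => (u m).eval (gaussC p i) := by
      simp_rw [gaussA_eq]; exact (hx _).symm
    refine ⟨fun i => ?_, ?_⟩
    · rw [hy]; exact ⟨(hc i).1, rfl⟩
    · simp_rw [gaussB_eq]; rw [← h1]; exact hx 1
  · rintro ⟨κ, hκ, h1⟩
    have hd (m : Fin M) := natDegree_add_sum_lagrangePrimitive (gaussC_injective p) 0 (y₀ m)
      fun j => Δt * κ j m
    have h0 := heval κ 0
    simp only [eval_lagrangePrimitive_self, zero_smul, Finset.sum_const_zero, smul_zero,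
      add_zero] at h0
    refine ⟨_, hd, h0, ?_, fun i => ?_⟩
    · rw [heval, h1]; simp_rw [gaussB_eq]
    · have hi := hκ i
      simp_rw [gaussA_eq] at hi
      rw [heval]
      refine ⟨hi.1, ?_⟩
      rw [← hi.2]
      ext m
      exact (eval_derivative_eq_iff hp (gaussC_injective p) 0 (hd m) _).mpr
        (by rw [congrFun h0 m]) i

/-- The substitution `τ = 2s - 1` doubles derivatives, turning `Δt / 2` into `Δt`. Conversely,
sampling at the Lobatto nodes loses nothing in degree at most `p`. -/
theorem exists_isMCISolution_iff_isGaussCollocationStep {M p : ℕ} (hp : 1 ≤ p) {Δt : ℝ}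
    (hΔ : Δt ≠ 0) {U : Set (Fin M → ℝ)} {h : (Fin M → ℝ) → Fin M → ℝ} {y₀ y₁ : Fin M → ℝ} :
    (∃ Y : Fin (p + 1) → Fin M → ℝ,
      IsMCISolution p Δt U h Y ∧ Y 0 = y₀ ∧ Y (Fin.last p) = y₁) ↔
    IsGaussCollocationStep p Δt U h y₀ y₁ := by
  have hg (i : Fin p) : gaussNode p i = 2 * gaussC p i - 1 := by rw [gaussC]; ring
  constructor
  · rintro ⟨Y, hY, h0, h1⟩
    have hcomp (m : Fin M) (x : ℝ) : ((trajectoryPoly p Y m).comp (2 * X - 1)).eval x =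
        (trajectoryPoly p Y m).eval (2 * x - 1) := by simp [eval_comp]
    refine ⟨fun m => (trajectoryPoly p Y m).comp (2 * X - 1), fun m => ?_, ?_, ?_, fun i => ?_⟩
    · have h2 : (2 * X - 1 : ℝ[X]).natDegree ≤ 1 := by compute_degree
      refine natDegree_comp_le.trans ?_
      calc _ ≤ (trajectoryPoly p Y m).natDegree * 1 := Nat.mul_le_mul_left _ h2
        _ ≤ p := by rw [mul_one]; exact natDegree_trajectoryPoly hp Y m
    · simp_rw [hcomp]
      rw [eval_trajectoryPoly, ← h0, ← trajectory_neg_one hp Y]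
      norm_num
    · simp_rw [hcomp]
      rw [eval_trajectoryPoly, ← h1, ← trajectory_one hp Y]
      norm_num
    · obtain ⟨hU, e⟩ := (isMCISolution_iff hp hΔ).mp hY i
      simp_rw [hcomp, ← hg, eval_trajectoryPoly]
      refine ⟨hU, ?_⟩
      rw [← eval_derivative_trajectoryPoly] at e
      ext m
      have em := congrFun e m
      simp only [Pi.smul_apply, smul_eq_mul] at em ⊢
      rw [derivative_comp, eval_mul, eval_comp]
      simp only [eval_sub, eval_mul, eval_X, eval_one, derivative_sub, derivative_mul,
        derivative_X, derivative_one, derivative_ofNat, eval_ofNat, eval_add, eval_zero]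
      rw [← hg, em]
      ring
  · rintro ⟨u, hu, h0, h1, hc⟩
    set v : Fin M → ℝ[X] := fun m => (u m).comp (C (1 / 2) * (X + 1)) with hv
    have hcomp (m : Fin M) (x : ℝ) : (v m).eval x = (u m).eval (1 / 2 * (x + 1)) := by
      simp [hv, eval_comp]
    have hder (m : Fin M) (x : ℝ) : (derivative (v m)).eval x =
        1 / 2 * (derivative (u m)).eval (1 / 2 * (x + 1)) := by
      simp [hv, derivative_comp, eval_comp]
    have hvd (m : Fin M) : (v m).natDegree ≤ p := by
      have h2 : (C (1 / 2) * (X + 1) : ℝ[X]).natDegree ≤ 1 := by compute_degree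
      refine natDegree_comp_le.trans ?_
      calc _ ≤ (u m).natDegree * 1 := Nat.mul_le_mul_left _ h2
        _ ≤ p := by rw [mul_one]; exact hu m
    have e := eq_trajectoryPoly hp hvd
    set Y : Fin (p + 1) → Fin M → ℝ := fun k m => (v m).eval (lobattoNode p k)
    have hgc (i : Fin p) : 1 / 2 * (gaussNode p i + 1) = gaussC p i := by rw [gaussC]; ring
    refine ⟨Y, (isMCISolution_iff hp hΔ).mpr fun i => ?_, ?_, ?_⟩
    · rw [← eval_trajectoryPoly, ← eval_derivative_trajectoryPoly, ← e]
      simp_rw [hcomp, hder, hgc]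
      refine ⟨(hc i).1, ?_⟩
      ext m
      have em := congrFun (hc i).2 m
      simp only [Pi.smul_apply, smul_eq_mul] at em ⊢
      rw [em]
      ring
    · rw [← h0]
      ext m
      simp only [Y, hcomp, lobattoNode_zero]
      norm_num
    · rw [← h1]
      ext m
      simp only [Y, hcomp, lobattoNode_last hp]
      norm_num

/-! ### Existence and uniqueness for small steps -/

/-- Integrating from `-1` gives a fixed-point equation with the factor `Δt` in front of the
nonlinearity, ready for a contraction argument. -/
theorem isMCISolution_iff_eq_add_sum {ι : Type*} {p : ℕ} (hp : 1 ≤ p) {Δt : ℝ} (hΔ : Δt ≠ 0)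
    {U : Set (ι → ℝ)} {h : (ι → ℝ) → ι → ℝ} {Y : Fin (p + 1) → ι → ℝ} :
    IsMCISolution p Δt U h Y ↔ (∀ j, trajectory p Y (gaussNode p j) ∈ U) ∧
      ∀ k, Y k = Y 0 + Δt • ∑ j, ((lagrangePrimitive (gaussNode p) (-1) j).eval
        (lobattoNode p k) / 2) • h (trajectory p Y (gaussNode p j)) := by
  rw [isMCISolution_iff hp hΔ, forall_and]
  refine and_congr_right fun _ => ?_
  set w : Fin p → ι → ℝ := fun j => (Δt / 2) • h (trajectory p Y (gaussNode p j)) with hw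
  have h0 (m : ι) : (trajectoryPoly p Y m).eval (-1) = Y 0 m :=
    congrFun ((eval_trajectoryPoly Y (-1)).trans (trajectory_neg_one hp Y)) m
  have hk (k : Fin (p + 1)) (m : ι) : (trajectoryPoly p Y m).eval (lobattoNode p k) = Y k m :=
    congrFun ((eval_trajectoryPoly Y _).trans (trajectory_lobattoNode hp Y k)) m
  calc (∀ j, ∑ k, (derivative (primalBasis p k)).eval (gaussNode p j) • Y k = w j)
      ↔ ∀ m, ∀ j, (derivative (trajectoryPoly p Y m)).eval (gaussNode p j) = w j m := by
        simp_rw [← eval_derivative_trajectoryPoly, funext_iff]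
        exact forall_comm
    _ ↔ ∀ m, trajectoryPoly p Y m =
          C (Y 0 m) + ∑ j, C (w j m) * lagrangePrimitive (gaussNode p) (-1) j :=
        forall_congr' fun m => by
          rw [eval_derivative_eq_iff hp (gaussNode_injective p) (-1)
            (natDegree_trajectoryPoly hp Y m), h0]
    _ ↔ ∀ m, ∀ k, Y k m = Y 0 m +
          ∑ j, w j m * (lagrangePrimitive (gaussNode p) (-1) j).eval (lobattoNode p k) := by
        refine forall_congr' fun m => ⟨fun e k => ?_, fun e => ?_⟩
        · rw [← hk, e]
          simp [eval_finsetSum]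
        · refine eq_of_eval_lobattoNode_eq hp (natDegree_trajectoryPoly hp Y m)
            (natDegree_add_sum_lagrangePrimitive (gaussNode_injective p) _ _ _) fun k => ?_
          rw [hk, e k]
          simp [eval_finsetSum]
    _ ↔ _ := by
        rw [forall_comm]
        refine forall_congr' fun k => ?_
        rw [funext_iff]
        refine forall_congr' fun m => ?_
        simp only [hw, Pi.add_apply, Pi.smul_apply, Finset.sum_apply, smul_eq_mul, Finset.mul_sum]
        refine iff_of_eq (congrArg _ (congrArg _ (Finset.sum_congr rfl fun j _ => ?_)))
        ring

theorem trajectory_const {V : Type*} [AddCommGroup V] [Module ℝ V] {p : ℕ} (hp : 1 ≤ p) (x : V)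
    (τ : ℝ) : trajectory p (fun _ => x) τ = x := by
  rw [trajectory, ← Finset.sum_smul, ← eval_finsetSum, sum_primalBasis hp]
  simp

/-- Near every point and for all small steps, the equations of the mimetic canonical integrator
have a unique solution, which depends smoothly and injectively on the initial value. -/
theorem exists_isMCIFamily {ι : Type*} [Fintype ι] {p : ℕ} (hp : 1 ≤ p) {U : Set (ι → ℝ)}
    {h : (ι → ℝ) → ι → ℝ} (hU : IsOpen U) (hh : ContDiffOn ℝ ∞ h U) {x : ι → ℝ} (hx : x ∈ U) :
    ∃ δ > 0, ∃ W N : Set (ι → ℝ), IsOpen W ∧ IsOpen N ∧ x ∈ W ∧ W ⊆ N ∧ N ⊆ U ∧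
      ∀ Δt : ℝ, Δt ≠ 0 → |Δt| < δ → ∃ Y : (ι → ℝ) → Fin (p + 1) → ι → ℝ,
        IsMCIFamily p Δt U h W Y ∧ (∀ y ∈ W, ∀ k, Y y k ∈ N) ∧
        (∀ y ∈ W, ∀ Z : Fin (p + 1) → ι → ℝ, Z 0 = y → (∀ k, Z k ∈ N) →
          IsMCISolution p Δt U h Z → Z = Y y) ∧
        ContDiffOn ℝ ∞ Y W ∧ Set.InjOn (fun y => Y y (Fin.last p)) W := by
  obtain ⟨K, t, ht, hK⟩ := ((hh.contDiffAt (hU.mem_nhds hx)).of_le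
    (by simp : (1 : WithTop ℕ∞) ≤ ∞)).exists_lipschitzOnWith
  obtain ⟨R, hR, hRsub⟩ := Metric.mem_nhds_iff.mp (Filter.inter_mem ht (hU.mem_nhds hx))
  let T : (Fin (p + 1) → ι → ℝ) →L[ℝ] (Fin p → ι → ℝ) := ContinuousLinearMap.pi fun j =>
    nodalCombination fun k => (primalBasis p k).eval (gaussNode p j)
  have hT (Z : Fin (p + 1) → ι → ℝ) (j : Fin p) : T Z j = trajectory p Z (gaussNode p j) :=
    nodalCombination_apply _ _
  let Q : (Fin p → ι → ℝ) →L[ℝ] (Fin (p + 1) → ι → ℝ) := ContinuousLinearMap.pi fun k =>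
    ∑ j, ((lagrangePrimitive (gaussNode p) (-1) j).eval (lobattoNode p k) / 2) •
      ContinuousLinearMap.proj j
  have hQ (z : Fin p → ι → ℝ) (k : Fin (p + 1)) : Q z k = ∑ j,
      ((lagrangePrimitive (gaussNode p) (-1) j).eval (lobattoNode p k) / 2) • z j := by
    simp [Q]
  let b : Fin (p + 1) → ι → ℝ := fun _ => x
  have hTb : ∀ᶠ Z in nhds b, ∀ j, T Z j ∈ Metric.ball x R := by
    rw [Filter.eventually_all]
    intro j
    have hc : Continuous fun Z => T Z j := (continuous_apply j).comp T.continuous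
    refine hc.continuousAt.eventually_mem ?_
    rw [hT, trajectory_const hp]
    exact Metric.ball_mem_nhds x hR
  obtain ⟨r₁, hr₁, hr₁T⟩ := Metric.eventually_nhds_iff_ball.mp hTb
  -- `r₁` keeps the values at the Gauss nodes where `h` is Lipschitz; `R` keeps the nodal values in
  -- `U`.
  set r := min r₁ R with hr_def
  have hr : 0 < r := lt_min hr₁ hR
  have hST (Z) (hZ : Z ∈ Metric.ball b r) (j : Fin p) : T Z j ∈ t ∩ U :=
    hRsub (hr₁T Z (Metric.ball_subset_ball (min_le_left _ _) hZ) j)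
  have hS (Z : Fin (p + 1) → ι → ℝ) : Z ∈ Metric.ball b r ↔ ∀ k, Z k ∈ Metric.ball x r := by
    rw [ball_pi _ hr]; simp [b]
  let F : (Fin (p + 1) → ι → ℝ) → Fin (p + 1) → ι → ℝ := fun Z => Q fun j => h (T Z j)
  have hFsm : ContDiffOn ℝ ∞ F (Metric.ball b r) := by
    refine Q.contDiff.comp_contDiffOn (contDiffOn_pi.mpr fun j => ?_)
    refine hh.comp (ContDiff.contDiffOn ?_) fun Z hZ => (hST Z hZ j).2
    exact (contDiff_apply ℝ (ι → ℝ) j).comp T.contDiff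
  set K' : NNReal := ‖Q‖₊ * (K * ‖T‖₊) with hK'
  have hFL : LipschitzOnWith K' F (Metric.ball b r) := by
    refine Q.lipschitz.comp_lipschitzOnWith (LipschitzOnWith.of_dist_le_mul fun Z hZ Z' hZ' => ?_)
    refine (dist_pi_le_iff (by positivity)).mpr fun j => ?_
    refine (hK.dist_le_mul _ (hST Z hZ j).1 _ (hST Z' hZ' j).1).trans ?_
    rw [NNReal.coe_mul, mul_assoc]
    gcongr
    exact (dist_le_pi_dist _ _ j).trans (T.lipschitz.dist_le_mul _ _)
  -- The two bounds make `Δt • F` Lipschitz with constant `1/4` and at most `r/8` at the centre, as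
  -- `exists_contDiffOn_solution` demands; each `+ 1` guards against a zero denominator.
  refine ⟨min (1 / (4 * (K' + 1))) (r / (8 * (‖F b‖ + 1))), by positivity,
    Metric.ball x (r / 8), Metric.ball x r, Metric.isOpen_ball, Metric.isOpen_ball,
    Metric.mem_ball_self (by positivity), Metric.ball_subset_ball (by linarith),
    fun y hy => (hRsub (Metric.ball_subset_ball (min_le_right _ _) hy)).2, fun Δt hΔ hδ => ?_⟩
  have hδ1 : |Δt| * K' ≤ 1 / 4 := by
    have h1 := hδ.trans_le (min_le_left _ _)
    rw [lt_div_iff₀ (by positivity)] at h1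
    nlinarith [abs_nonneg Δt, K'.coe_nonneg]
  have hδ2 : |Δt| * ‖F b‖ ≤ r / 8 := by
    have h1 := hδ.trans_le (min_le_right _ _)
    rw [lt_div_iff₀ (by positivity)] at h1
    nlinarith [abs_nonneg Δt, norm_nonneg (F b)]
  have hL : LipschitzOnWith (1 / 4) (fun Z => Δt • F Z) (Metric.ball b r) :=
    LipschitzOnWith.of_dist_le_mul fun Z hZ Z' hZ' => by
      rw [dist_smul₀, Real.norm_eq_abs]
      have h1 := hFL.dist_le_mul Z hZ Z' hZ'
      calc |Δt| * dist (F Z) (F Z') ≤ |Δt| * (K' * dist Z Z') := by gcongr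
        _ = |Δt| * K' * dist Z Z' := by ring
        _ ≤ 1 / 4 * dist Z Z' := by gcongr
        _ = ((1 / 4 : NNReal) : ℝ) * dist Z Z' := by norm_num
  have hsm : ContDiffOn ℝ ∞ (fun Z => Δt • F Z) (Metric.ball b r) := hFsm.const_smul Δt
  have hb : ‖Δt • F b‖ ≤ r / 8 := by rwa [norm_smul, Real.norm_eq_abs]
  obtain ⟨Θ, hΘsm, hΘ, huniq⟩ := exists_contDiffOn_solution hr hsm hL hb
  have hmem {y : ι → ℝ} (hy : y ∈ Metric.ball x (r / 8)) :
      (fun _ => y) ∈ Metric.ball b (r / 8) := by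
    rw [ball_pi _ (by positivity)]; simpa [b] using hy
  -- The primitives vanish at the node `-1`, so the zeroth component of the equation is just the
  -- initial condition.
  have hF0 (Z : Fin (p + 1) → ι → ℝ) : F Z 0 = 0 := by
    simp only [F, hQ, lobattoNode_zero, eval_lagrangePrimitive_self]
    simp
  have hsol {Z : Fin (p + 1) → ι → ℝ} (hZ : Z ∈ Metric.ball b r) :
      IsMCISolution p Δt U h Z ↔ Z - Δt • F Z = fun _ => Z 0 := by
    rw [isMCISolution_iff_eq_add_sum hp hΔ, and_iff_right fun j => hT Z j ▸ (hST Z hZ j).2,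
      funext_iff]
    refine forall_congr' fun k => ?_
    simp only [Pi.sub_apply, Pi.smul_apply, F, hQ, hT]
    exact sub_eq_iff_eq_add.symm
  refine ⟨fun y => Θ fun _ => y, fun y hy => ?_, fun y hy => (hS _).mp (hΘ _ (hmem hy)).1,
    fun y hy Z hZ0 hZN hZ => ?_, ?_, fun y hy y' hy' e => ?_⟩
  · obtain ⟨h1, h2⟩ := hΘ _ (hmem hy)
    have h0 : Θ (fun _ => y) 0 = y := by
      have := congrFun h2 0
      simpa [hF0] using this
    refine ⟨h0, (hsol h1).mpr ?_⟩
    rw [h0, h2]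
  · have hZS := (hS Z).mpr hZN
    exact huniq _ Z hZS (by rw [(hsol hZS).mp hZ, hZ0])
  · exact hΘsm.comp (contDiff_pi.mpr fun _ => contDiff_id).contDiffOn fun y hy => hmem hy
  · obtain ⟨h1, h2⟩ := hΘ _ (hmem hy)
    obtain ⟨h1', h2'⟩ := hΘ _ (hmem hy')
    set Z := Θ fun _ => y
    set Z' := Θ fun _ => y'
    have hd : ‖Δt • F Z - Δt • F Z'‖ ≤ 1 / 4 * ‖Z - Z'‖ := by
      simpa using hL.norm_sub_le h1 h1'
    have e1 : Z - Z' = (fun _ => y - y') + (Δt • F Z - Δt • F Z') := by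
      have : (fun _ : Fin (p + 1) => y - y') = (fun _ => y) - fun _ => y' := rfl
      rw [this, ← h2, ← h2']
      abel
    have e : Z (Fin.last p) = Z' (Fin.last p) := e
    have e2 : y - y' = -(Δt • F Z - Δt • F Z') (Fin.last p) := by
      have := congrFun e1 (Fin.last p)
      simp only [Pi.sub_apply, Pi.add_apply, Pi.smul_apply] at this e ⊢
      rw [e, sub_self] at this
      exact eq_neg_of_add_eq_zero_left this.symm
    -- With `n2`, which uses that the final values agree, this gives `‖y - y'‖ ≤ ‖y - y'‖ / 3`.
    have n1 : ‖Z - Z'‖ ≤ ‖y - y'‖ + 1 / 4 * ‖Z - Z'‖ := by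
      conv_lhs => rw [e1]
      refine (norm_add_le _ _).trans (add_le_add ?_ hd)
      exact (pi_norm_const_le _)
    have n2 : ‖y - y'‖ ≤ 1 / 4 * ‖Z - Z'‖ := by
      rw [e2, norm_neg]
      exact (norm_le_pi_norm _ _).trans hd
    exact sub_eq_zero.mp (norm_le_zero_iff.mp (by linarith))
-- Assembly of the three assertions
theorem mainTheorem1 (p : ℕ) (hp : 1 ≤ p) :
    -- symplecticity, for every smooth Hamiltonian system
    (∀ (n : ℕ) (U : Set (PhaseSpace n)) (H : PhaseSpace n → ℝ), IsOpen U → ContDiffOn ℝ ∞ H U →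
      -- every differentiable one-step map preserves the symplectic form
      (∀ (Δt : ℝ) (W : Set (PhaseSpace n)) (Y : PhaseSpace n → Fin (p + 1) → PhaseSpace n),
        Δt ≠ 0 → IsOpen W → IsMCIFamily p Δt U (hamiltonianField H) W Y →
        DifferentiableOn ℝ Y W →
        PreservesSymplecticForm (fun y => Y y (Fin.last p)) W) ∧
      -- every smooth injective one-step map is a symplectic map
      (∀ (Δt : ℝ) (W : Set (PhaseSpace n)) (Y : PhaseSpace n → Fin (p + 1) → PhaseSpace n),
        Δt ≠ 0 → IsOpen W → IsMCIFamily p Δt U (hamiltonianField H) W Y →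
        ContDiffOn ℝ ∞ Y W → Set.InjOn (fun y => Y y (Fin.last p)) W →
        IsSymplecticMapOn (fun y => Y y (Fin.last p)) W) ∧
      -- near every point and for all small steps the one-step map exists, is unique, and is
      -- a symplectic map
      (∀ x ∈ U, ∃ δ > 0, ∃ W N : Set (PhaseSpace n),
        IsOpen W ∧ IsOpen N ∧ x ∈ W ∧ W ⊆ N ∧ N ⊆ U ∧
        ∀ Δt : ℝ, Δt ≠ 0 → |Δt| < δ →
          ∃ Y : PhaseSpace n → Fin (p + 1) → PhaseSpace n,
            IsMCIFamily p Δt U (hamiltonianField H) W Y ∧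
            (∀ y ∈ W, ∀ k, Y y k ∈ N) ∧
            (∀ y ∈ W, ∀ Z : Fin (p + 1) → PhaseSpace n, Z 0 = y → (∀ k, Z k ∈ N) →
              IsMCISolution p Δt U (hamiltonianField H) Z → Z = Y y) ∧
            ContDiffOn ℝ ∞ Y W ∧
            IsSymplecticMapOn (fun y => Y y (Fin.last p)) W)) ∧
    -- the integrator is the implicit Runge–Kutta method with the Gauss coefficients, and Gauss
    -- collocation, for every system of ordinary differential equations
    (∃ i j : Fin p, i ≤ j ∧ gaussA p i j ≠ 0) ∧
    (∀ (M : ℕ) (U : Set (Fin M → ℝ)) (h : (Fin M → ℝ) → (Fin M → ℝ)) (Δt : ℝ)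
      (y₀ y₁ : Fin M → ℝ), Δt ≠ 0 →
      ((∃ Y : Fin (p + 1) → Fin M → ℝ,
          IsMCISolution p Δt U h Y ∧ Y 0 = y₀ ∧ Y (Fin.last p) = y₁) ↔
        IsRungeKuttaStep (gaussA p) (gaussB p) Δt U h y₀ y₁) ∧
      ((∃ Y : Fin (p + 1) → Fin M → ℝ,
          IsMCISolution p Δt U h Y ∧ Y 0 = y₀ ∧ Y (Fin.last p) = y₁) ↔
        IsGaussCollocationStep p Δt U h y₀ y₁)) ∧
    -- it conserves every quadratic first integral
    (∀ (M : ℕ) (U : Set (Fin M → ℝ)) (h : (Fin M → ℝ) → (Fin M → ℝ))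
      (S : Matrix (Fin M) (Fin M) ℝ), S.IsSymm → (∀ y ∈ U, y ⬝ᵥ S.mulVec (h y) = 0) →
      ∀ (Δt : ℝ) (Y : Fin (p + 1) → Fin M → ℝ), Δt ≠ 0 → IsMCISolution p Δt U h Y →
        Y (Fin.last p) ⬝ᵥ S.mulVec (Y (Fin.last p)) = Y 0 ⬝ᵥ S.mulVec (Y 0)) := by
  refine ⟨fun n U H hU hH => ⟨?_, ?_, ?_⟩, exists_gaussA_ne_zero hp, ?_, ?_⟩
  · intro Δt W Y hΔ hW hY hd
    exact hY.preservesSymplecticForm hp hU hH hΔ hW hd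
  · intro Δt W Y hΔ hW hY hs hinj
    exact isSymplecticMapOn_of_injOn hW (contDiffOn_pi.mp hs _) hinj
      (hY.preservesSymplecticForm hp hU hH hΔ hW (hs.differentiableOn (by simp)))
  · intro x hx
    obtain ⟨δ, hδ, W, N, hW, hN, hxW, hWN, hNU, hfam⟩ := exists_isMCIFamily hp hU
      (fun z hz => (contDiffAt_hamiltonianField
        (hH.contDiffAt (hU.mem_nhds hz))).contDiffWithinAt) hx
    refine ⟨δ, hδ, W, N, hW, hN, hxW, hWN, hNU, fun Δt hΔ hΔδ => ?_⟩
    obtain ⟨Y, hY, hYN, huniq, hs, hinj⟩ := hfam Δt hΔ hΔδ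
    exact ⟨Y, hY, hYN, huniq, hs, isSymplecticMapOn_of_injOn hW (contDiffOn_pi.mp hs _) hinj
      (hY.preservesSymplecticForm hp hU hH hΔ hW (hs.differentiableOn (by simp)))⟩
  · intro M U h Δt y₀ y₁ hΔ
    have e := exists_isMCISolution_iff_isGaussCollocationStep hp hΔ (U := U) (h := h) (y₀ := y₀)
      (y₁ := y₁)
    exact ⟨e.trans (isGaussCollocationStep_iff_isRungeKuttaStep hp), e⟩
  · intro M U h S hS hU Δt Y hΔ hY
    exact hY.quadratic_conserved hp hΔ hS hU
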